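/- Rings and algebras are associative but need not be unital. A ring $A$ is called *locally semisimple* if every finite subset of $A$ is contained in a subring of the form $eAe$ with $e\in A$ idempotent, and for every idempotent $e\in A$ the unital ring $eAe$ is semisimple. Let $\mathbb K$ be a field of characteristic zero, let $\mathcal K$ be a set of finite groups, and let $\ell:\mathbb N\setminus\{0\}\to\mathbb K^\times$ be a monoid homomorphism from the multiplicative monoid of positive integers to the unit group of $\mathbb K$. Let $\mathcal S_{\mathcal K}$ be the category whose set of objects is $\mathcal K$ and whose morphisms $F\leftarrow G$, for $F,G\in\mathcal K$, are the subgroups of $F\times G$; the composite of $U\le F\times G$ and $V\le G\times H$ is the star product $$U*V=\{(f,h)\in F\times H : \text{there exists } g\in G \text{ with } (f,g)\in U \text{ and } (g,h)\in V\}.$$ Put $U_\bullet=\{g\in G:(1,g)\in U\}$ and ${}_\bullet V=\{g\in G:(g,1)\in V\}$. The formula $\sigma(U,V)=\ell(|U_\bullet\cap{}_\bullet V|)$ defines a cocycle for $\mathcal S_{\mathcal K}$ with values in $\mathbb K^\times$. Let $\Lambda$ be the associated twisted category algebra, that is, the $\mathbb K$-algebra with a $\mathbb K$-basis consisting of elements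 $s_U^{F,G}$ for $F,G\in\mathcal K$ and $U\le F\times G$, and with multiplication given by $$s_U^{F,G}\,s_V^{G,H}=\sigma(U,V)\,s_{U*V}^{F,H},\qquad s_U^{F,G}\,s_V^{G',H}=0\ \text{ if } G\ne G'.$$ **Theorem 1.1.** Suppose that the elements $\ell(q)$, with $q$ running over the primes that divide the order of some group in $\mathcal K$, are algebraically independent over $\mathbb Q$. Then $\Lambda$ is locally semisimple. -/

import Mathlib

open CategoryTheory

universe u v w

/-! ### Locally semisimple rings -/

/-- A (not necessarily unital) ring `A` is locally unital when every finite subset of `A` is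
contained in a unital corner subring, that is, in a subring `e A e` with `e` idempotent. -/
def IsLocallyUnital (A : Type u) [NonUnitalRing A] : Prop :=
  ∀ s : Finset A, ∃ e : A, IsIdempotentElem e ∧ ∀ a ∈ s, ∃ b : A, e * b * e = a

/-- A (not necessarily unital) ring `A` is locally semisimple when it is locally unital and
every unital corner subring `e A e`, with `e` idempotent, is a semisimple ring. -/
def IsLocallySemisimple (A : Type u) [NonUnitalRing A] : Prop :=
  IsLocallyUnital A ∧ ∀ (e : A) (he : IsIdempotentElem e), IsSemisimpleRing he.Corner

/-! ### Cocycles and twisted category algebras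

A morphism `θ : X ← Y` is written `θ : Y ⟶ X`, and the composite `θ ∘ φ` of `θ : X ← Y` and
`φ : Y ← Z` is written `φ ≫ θ`. -/

/-- A cocycle for the category `C` over `𝕂`, with values in the unit group of `𝕂`:
`γ (θ, φ) γ (θ ∘ φ, ψ) = γ (θ, φ ∘ ψ) γ (φ, ψ)`. -/
structure TwistingCocycle (𝕂 : Type w) [Field 𝕂] (C : Type u) [Category.{v} C] where
  /-- the value `γ (θ, φ)` for `θ : X ← Y` and `φ : Y ← Z` -/
  val : ∀ {X Y Z : C}, (Y ⟶ X) → (Z ⟶ Y) → 𝕂ˣ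
  cocycle : ∀ {W X Y Z : C} (θ : X ⟶ W) (φ : Y ⟶ X) (ψ : Z ⟶ Y),
    val θ φ * val (φ ≫ θ) ψ = val θ (ψ ≫ φ) * val φ ψ

/-- The morphisms of `C`, each of them together with its codomain and its domain. -/
structure Mor (C : Type u) [Category.{v} C] where
  /-- the codomain -/
  cod : C
  /-- the domain -/
  dom : C
  /-- the morphism `cod ← dom` -/
  hom : dom ⟶ cod

/-- The twisted category algebra of `C` over `𝕂` associated with the cocycle `γ`: as a vector
space over `𝕂` it has the morphisms of `C` as a basis. -/
def TwistedCategoryAlgebra {𝕂 : Type w} [Field 𝕂] {C : Type u} [Category.{v} C]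
    (_γ : TwistingCocycle 𝕂 C) : Type (max u v w) :=
  Mor C →₀ 𝕂

namespace TwistedCategoryAlgebra

variable {𝕂 : Type w} [Field 𝕂] {C : Type u} [Category.{v} C] (γ : TwistingCocycle 𝕂 C)

noncomputable instance : AddCommGroup (TwistedCategoryAlgebra γ) :=
  inferInstanceAs (AddCommGroup (Mor C →₀ 𝕂))

noncomputable instance : Module 𝕂 (TwistedCategoryAlgebra γ) :=
  inferInstanceAs (Module 𝕂 (Mor C →₀ 𝕂))

/-- The basis of the twisted category algebra that consists of the morphisms of `C`. -/
noncomputable def morBasis : Module.Basis (Mor C) 𝕂 (TwistedCategoryAlgebra γ) :=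
  Module.Basis.ofRepr (LinearEquiv.refl 𝕂 (Mor C →₀ 𝕂))

/-- The basis element given by a morphism. -/
noncomputable def basisElem (a : Mor C) : TwistedCategoryAlgebra γ :=
  morBasis γ a

open Classical in
/-- The product of two basis elements: `γ (a, b)` times the composite `a ∘ b` when `a` and `b`
are composable, and zero otherwise. -/
noncomputable def basisMul (a b : Mor C) : TwistedCategoryAlgebra γ :=
  if h : b.cod = a.dom then
    (γ.val a.hom (b.hom ≫ eqToHom h) : 𝕂) •
      basisElem γ ⟨a.cod, b.dom, (b.hom ≫ eqToHom h) ≫ a.hom⟩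
  else 0

/-- The bilinear extension of the product of basis elements. -/
noncomputable def mulMap :
    TwistedCategoryAlgebra γ →ₗ[𝕂] TwistedCategoryAlgebra γ →ₗ[𝕂] TwistedCategoryAlgebra γ :=
  (morBasis γ).constr 𝕂 fun a => (morBasis γ).constr 𝕂 fun b => basisMul γ a b

noncomputable instance : Mul (TwistedCategoryAlgebra γ) := ⟨fun x y => mulMap γ x y⟩

theorem mul_eq_mulMap (x y : TwistedCategoryAlgebra γ) : x * y = mulMap γ x y := rfl

theorem basisElem_mul_basisElem (a b : Mor C) :
    basisElem γ a * basisElem γ b = basisMul γ a b := by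
  simp only [mul_eq_mulMap, mulMap, basisElem, Module.Basis.constr_basis]

theorem basisElem_mul_of_comp {X Y Z : C} (θ : Y ⟶ X) (φ : Z ⟶ Y) :
    basisElem γ ⟨X, Y, θ⟩ * basisElem γ ⟨Y, Z, φ⟩ =
      (γ.val θ φ : 𝕂) • basisElem γ ⟨X, Z, φ ≫ θ⟩ := by
  simp [basisElem_mul_basisElem, basisMul]

theorem basisElem_mul_of_ne (a b : Mor C) (h : b.cod ≠ a.dom) :
    basisElem γ a * basisElem γ b = 0 := by
  simp [basisElem_mul_basisElem, basisMul, h]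

variable {γ} in
theorem induction_basis {p : TwistedCategoryAlgebra γ → Prop} (x : TwistedCategoryAlgebra γ)
    (zero : p 0) (add : ∀ y z, p y → p z → p (y + z))
    (smul : ∀ (c : 𝕂) (a : Mor C), p (c • basisElem γ a)) : p x := by
  have hx : x ∈ Submodule.span 𝕂 (Set.range (morBasis γ)) := by
    rw [(morBasis γ).span_eq]
    exact Submodule.mem_top
  induction hx using Submodule.closure_induction with
  | zero => exact zero
  | add y z _ _ hy hz => exact add y z hy hz
  | smul_mem c y hy =>
    obtain ⟨a, rfl⟩ := hy
    exact smul c a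

protected theorem smul_mul (c : 𝕂) (x y : TwistedCategoryAlgebra γ) :
    c • x * y = c • (x * y) := by
  simp [mul_eq_mulMap]

protected theorem mul_smul' (c : 𝕂) (x y : TwistedCategoryAlgebra γ) :
    x * c • y = c • (x * y) := by
  simp [mul_eq_mulMap]

protected theorem left_distrib' (x y z : TwistedCategoryAlgebra γ) :
    x * (y + z) = x * y + x * z := by
  simp [mul_eq_mulMap]

protected theorem right_distrib' (x y z : TwistedCategoryAlgebra γ) :
    (x + y) * z = x * z + y * z := by
  simp [mul_eq_mulMap]

protected theorem zero_mul' (x : TwistedCategoryAlgebra γ) : 0 * x = 0 := by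
  simp [mul_eq_mulMap]

protected theorem mul_zero' (x : TwistedCategoryAlgebra γ) : x * 0 = 0 := by
  simp [mul_eq_mulMap]

theorem basisElem_mul_assoc (a b c : Mor C) :
    basisElem γ a * basisElem γ b * basisElem γ c =
      basisElem γ a * (basisElem γ b * basisElem γ c) := by
  obtain ⟨W, X, θ⟩ := a
  obtain ⟨X', Y, φ⟩ := b
  obtain ⟨Y', Z, ψ⟩ := c
  by_cases h₁ : X' = X
  · subst h₁
    by_cases h₂ : Y' = Y
    · subst h₂
      have h := congrArg (fun t : 𝕂ˣ => (t : 𝕂)) (γ.cocycle θ φ ψ)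
      simp only [Units.val_mul] at h
      simp only [basisElem_mul_of_comp, TwistedCategoryAlgebra.smul_mul,
        TwistedCategoryAlgebra.mul_smul', smul_smul, Category.assoc, h]
      rw [mul_comm]
    · rw [basisElem_mul_of_ne γ ⟨X', Y, φ⟩ ⟨Y', Z, ψ⟩ h₂,
        basisElem_mul_of_comp, TwistedCategoryAlgebra.smul_mul,
        basisElem_mul_of_ne γ _ _ h₂, smul_zero, TwistedCategoryAlgebra.mul_zero']
  · rw [basisElem_mul_of_ne γ ⟨W, X, θ⟩ ⟨X', Y, φ⟩ h₁,
      TwistedCategoryAlgebra.zero_mul']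
    by_cases h₂ : Y' = Y
    · subst h₂
      rw [basisElem_mul_of_comp, TwistedCategoryAlgebra.mul_smul',
        basisElem_mul_of_ne γ _ _ h₁, smul_zero]
    · rw [basisElem_mul_of_ne γ ⟨X', Y, φ⟩ ⟨Y', Z, ψ⟩ h₂,
        TwistedCategoryAlgebra.mul_zero']

protected theorem mul_assoc' (x y z : TwistedCategoryAlgebra γ) : x * y * z = x * (y * z) := by
  induction x using induction_basis with
  | zero => simp only [TwistedCategoryAlgebra.zero_mul']
  | add x₁ x₂ h₁ h₂ => simp only [TwistedCategoryAlgebra.right_distrib', h₁, h₂]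
  | smul r a =>
    induction y using induction_basis with
    | zero => simp only [TwistedCategoryAlgebra.zero_mul', TwistedCategoryAlgebra.mul_zero']
    | add y₁ y₂ h₁ h₂ =>
      simp only [TwistedCategoryAlgebra.right_distrib', TwistedCategoryAlgebra.left_distrib',
        h₁, h₂]
    | smul s b =>
      induction z using induction_basis with
      | zero => simp only [TwistedCategoryAlgebra.mul_zero']
      | add z₁ z₂ h₁ h₂ => simp only [TwistedCategoryAlgebra.left_distrib', h₁, h₂]
      | smul t c =>
        simp only [TwistedCategoryAlgebra.smul_mul, TwistedCategoryAlgebra.mul_smul',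
          basisElem_mul_assoc]

noncomputable instance : NonUnitalRing (TwistedCategoryAlgebra γ) where
  left_distrib := TwistedCategoryAlgebra.left_distrib' γ
  right_distrib := TwistedCategoryAlgebra.right_distrib' γ
  zero_mul := TwistedCategoryAlgebra.zero_mul' γ
  mul_zero := TwistedCategoryAlgebra.mul_zero' γ
  mul_assoc := TwistedCategoryAlgebra.mul_assoc' γ

instance : IsScalarTower 𝕂 (TwistedCategoryAlgebra γ) (TwistedCategoryAlgebra γ) :=
  ⟨fun c x y => TwistedCategoryAlgebra.smul_mul γ c x y⟩

instance : SMulCommClass 𝕂 (TwistedCategoryAlgebra γ) (TwistedCategoryAlgebra γ) :=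
  ⟨fun c x y => (TwistedCategoryAlgebra.mul_smul' γ c x y).symm⟩

end TwistedCategoryAlgebra

/-! ### The subgroup category -/

section StarProduct

variable {R S T I : Type*} [Group R] [Group S] [Group T] [Group I]

/-- The star product `U * V` of `U ≤ R × S` and `V ≤ S × T`. -/
def starProd (U : Subgroup (R × S)) (V : Subgroup (S × T)) : Subgroup (R × T) where
  carrier := {p | ∃ s : S, (p.1, s) ∈ U ∧ (s, p.2) ∈ V}
  one_mem' := ⟨1, U.one_mem, V.one_mem⟩
  mul_mem' := by
    rintro _ _ ⟨s, h₁, h₂⟩ ⟨s', h₁', h₂'⟩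
    exact ⟨s * s', U.mul_mem h₁ h₁', V.mul_mem h₂ h₂'⟩
  inv_mem' := by
    rintro _ ⟨s, h₁, h₂⟩
    exact ⟨s⁻¹, U.inv_mem h₁, V.inv_mem h₂⟩

theorem mem_starProd {U : Subgroup (R × S)} {V : Subgroup (S × T)} {r : R} {t : T} :
    (r, t) ∈ starProd U V ↔ ∃ s : S, (r, s) ∈ U ∧ (s, t) ∈ V := Iff.rfl

/-- The diagonal subgroup `Δ(R)` of `R × R`. -/
def diagonalSubgroup (R : Type*) [Group R] : Subgroup (R × R) :=
  ((MonoidHom.id R).prod (MonoidHom.id R)).range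

theorem mem_diagonalSubgroup {a b : R} : (a, b) ∈ diagonalSubgroup R ↔ a = b := by
  simp [diagonalSubgroup, MonoidHom.mem_range, Prod.ext_iff]

theorem starProd_diagonal (U : Subgroup (R × S)) : starProd U (diagonalSubgroup S) = U := by
  ext ⟨r, s⟩
  simp [mem_starProd, mem_diagonalSubgroup]

theorem diagonal_starProd (U : Subgroup (R × S)) : starProd (diagonalSubgroup R) U = U := by
  ext ⟨r, s⟩
  simp [mem_starProd, mem_diagonalSubgroup]

theorem starProd_assoc (U : Subgroup (R × S)) (V : Subgroup (S × T)) (W : Subgroup (T × I)) :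
    starProd (starProd U V) W = starProd U (starProd V W) := by
  ext ⟨r, i⟩
  simp only [mem_starProd]
  constructor
  · rintro ⟨t, ⟨s, h₁, h₂⟩, h₃⟩
    exact ⟨s, h₁, t, h₂, h₃⟩
  · rintro ⟨s, h₁, t, h₂, h₃⟩
    exact ⟨t, ⟨s, h₁, h₂⟩, h₃⟩

/-- The subgroup `{r | (r, 1) ∈ U}` of `R`, for `U ≤ R × S` (a bullet as left subscript). -/
def leftBullet (U : Subgroup (R × S)) : Subgroup R := U.comap (MonoidHom.inl R S)

/-- The subgroup `{s | (1, s) ∈ U}` of `S`, for `U ≤ R × S` (a bullet as right subscript). -/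
def rightBullet (U : Subgroup (R × S)) : Subgroup S := U.comap (MonoidHom.inr R S)

theorem mem_leftBullet {U : Subgroup (R × S)} {r : R} : r ∈ leftBullet U ↔ (r, 1) ∈ U := Iff.rfl

theorem mem_rightBullet {U : Subgroup (R × S)} {s : S} : s ∈ rightBullet U ↔ (1, s) ∈ U := Iff.rfl

/-- The subgroup of `S × T` used to compare the two sides of the cocycle identity. -/
def linkSubgroup (U : Subgroup (R × S)) (V : Subgroup (S × T)) (W : Subgroup (T × I)) :
    Subgroup (S × T) :=
  (rightBullet U).comap (MonoidHom.fst S T) ⊓ V ⊓ (leftBullet W).comap (MonoidHom.snd S T)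

theorem mem_linkSubgroup {U : Subgroup (R × S)} {V : Subgroup (S × T)} {W : Subgroup (T × I)}
    {s : S} {t : T} :
    (s, t) ∈ linkSubgroup U V W ↔ ((1, s) ∈ U ∧ (s, t) ∈ V) ∧ (t, 1) ∈ W := Iff.rfl

/-- For `A ≤ S × T`, the order of `A` is the product of the orders of its image in `S` and of
`{t | (1, t) ∈ A}`. -/
theorem card_eq_fst (A : Subgroup (S × T)) :
    Nat.card A = Nat.card (A.map (MonoidHom.fst S T)) * Nat.card (rightBullet A) := by
  let f : A →* S := (MonoidHom.fst S T).comp A.subtype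
  have h₁ : Nat.card f.range = Nat.card (A.map (MonoidHom.fst S T)) := by
    rw [MonoidHom.range_comp, Subgroup.range_subtype]
  have h₂ : Nat.card f.ker = Nat.card (rightBullet A) := by
    refine Nat.card_congr
      { toFun := fun x => ⟨x.1.1.2, ?_⟩
        invFun := fun t => ⟨⟨(1, t.1), t.2⟩, rfl⟩
        left_inv := ?_
        right_inv := fun _ => rfl }
    · obtain ⟨⟨⟨s, t⟩, hA⟩, hs⟩ := x
      obtain rfl : s = 1 := hs
      exact hA
    · rintro ⟨⟨⟨s, t⟩, hA⟩, hs⟩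
      obtain rfl : s = 1 := hs
      rfl
  rw [← h₁, ← h₂, ← Subgroup.index_ker f, Subgroup.index_mul_card]

/-- For `A ≤ S × T`, the order of `A` is the product of the orders of its image in `T` and of
`{s | (s, 1) ∈ A}`. -/
theorem card_eq_snd (A : Subgroup (S × T)) :
    Nat.card A = Nat.card (A.map (MonoidHom.snd S T)) * Nat.card (leftBullet A) := by
  let f : A →* T := (MonoidHom.snd S T).comp A.subtype
  have h₁ : Nat.card f.range = Nat.card (A.map (MonoidHom.snd S T)) := by
    rw [MonoidHom.range_comp, Subgroup.range_subtype]
  have h₂ : Nat.card f.ker = Nat.card (leftBullet A) := by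
    refine Nat.card_congr
      { toFun := fun x => ⟨x.1.1.1, ?_⟩
        invFun := fun s => ⟨⟨(s.1, 1), s.2⟩, rfl⟩
        left_inv := ?_
        right_inv := fun _ => rfl }
    · obtain ⟨⟨⟨s, t⟩, hA⟩, ht⟩ := x
      obtain rfl : t = 1 := ht
      exact hA
    · rintro ⟨⟨⟨s, t⟩, hA⟩, ht⟩
      obtain rfl : t = 1 := ht
      rfl
  rw [← h₁, ← h₂, ← Subgroup.index_ker f, Subgroup.index_mul_card]

/-- The identity of orders which makes `σ` a cocycle. -/
theorem card_bullet_identity (U : Subgroup (R × S)) (V : Subgroup (S × T))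
    (W : Subgroup (T × I)) :
    Nat.card ↥(rightBullet U ⊓ leftBullet V) *
        Nat.card ↥(rightBullet (starProd U V) ⊓ leftBullet W) =
      Nat.card ↥(rightBullet U ⊓ leftBullet (starProd V W)) *
        Nat.card ↥(rightBullet V ⊓ leftBullet W) := by
  have a₁ : (linkSubgroup U V W).map (MonoidHom.fst S T) =
      rightBullet U ⊓ leftBullet (starProd V W) := by
    ext s
    constructor
    · rintro ⟨⟨s, t⟩, h, rfl⟩
      obtain ⟨⟨h₁, h₂⟩, h₃⟩ := mem_linkSubgroup.1 h
      exact ⟨h₁, t, h₂, h₃⟩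
    · rintro ⟨h₁, t, h₂, h₃⟩
      exact ⟨(s, t), mem_linkSubgroup.2 ⟨⟨h₁, h₂⟩, h₃⟩, rfl⟩
  have a₂ : rightBullet (linkSubgroup U V W) = rightBullet V ⊓ leftBullet W := by
    ext t
    constructor
    · intro h
      obtain ⟨⟨-, h₂⟩, h₃⟩ := mem_linkSubgroup.1 h
      exact ⟨h₂, h₃⟩
    · rintro ⟨h₂, h₃⟩
      exact mem_linkSubgroup.2 ⟨⟨U.one_mem, h₂⟩, h₃⟩
  have a₃ : (linkSubgroup U V W).map (MonoidHom.snd S T) =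
      rightBullet (starProd U V) ⊓ leftBullet W := by
    ext t
    constructor
    · rintro ⟨⟨s, t⟩, h, rfl⟩
      obtain ⟨⟨h₁, h₂⟩, h₃⟩ := mem_linkSubgroup.1 h
      exact ⟨⟨s, h₁, h₂⟩, h₃⟩
    · rintro ⟨⟨s, h₁, h₂⟩, h₃⟩
      exact ⟨(s, t), mem_linkSubgroup.2 ⟨⟨h₁, h₂⟩, h₃⟩, rfl⟩
  have a₄ : leftBullet (linkSubgroup U V W) = rightBullet U ⊓ leftBullet V := by
    ext s
    constructor
    · intro h
      obtain ⟨⟨h₁, h₂⟩, -⟩ := mem_linkSubgroup.1 h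
      exact ⟨h₁, h₂⟩
    · rintro ⟨h₁, h₂⟩
      exact mem_linkSubgroup.2 ⟨⟨h₁, h₂⟩, W.one_mem⟩
  have e₁ := card_eq_fst (linkSubgroup U V W)
  have e₂ := card_eq_snd (linkSubgroup U V W)
  rw [a₁, a₂] at e₁
  rw [a₃, a₄] at e₂
  rw [← e₁, e₂, mul_comm]

end StarProduct

/-- The objects of the subgroup category on the set `𝒦` of finite groups. -/
structure SubgroupCat (𝒦 : Set FiniteGrp.{u}) where
  /-- the underlying finite group -/
  grp : FiniteGrp.{u}
  mem : grp ∈ 𝒦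

/-- The full subcategory on `𝒦` of the subgroup category: the morphisms `R ← S` are the
subgroups of `R × S`, the composition is the star product, and the identity of `R` is the
diagonal subgroup of `R × R`. -/
instance (𝒦 : Set FiniteGrp.{u}) : Category.{u} (SubgroupCat 𝒦) where
  Hom S R := Subgroup (R.grp × S.grp)
  id R := diagonalSubgroup R.grp
  comp V U := starProd U V
  id_comp U := starProd_diagonal U
  comp_id U := diagonal_starProd U
  assoc W V U := (starProd_assoc U V W).symm

/-- `ℓ(F)`, meaning `ℓ` at the order of the finite group `F`. -/
noncomputable def ellCard {𝕂 : Type v} [Field 𝕂] (ℓ : ℕ+ →* 𝕂ˣ) (F : Type u) [Group F]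
    [Finite F] : 𝕂ˣ :=
  ℓ (Nat.toPNat (Nat.card F) Nat.card_pos)

theorem ellCard_identity {𝕂 : Type v} [Field 𝕂] (ℓ : ℕ+ →* 𝕂ˣ) {R S T I : Type u}
    [Group R] [Group S] [Group T] [Group I] [Finite S] [Finite T]
    (U : Subgroup (R × S)) (V : Subgroup (S × T)) (W : Subgroup (T × I)) :
    ellCard ℓ ↥(rightBullet U ⊓ leftBullet V) *
        ellCard ℓ ↥(rightBullet (starProd U V) ⊓ leftBullet W) =
      ellCard ℓ ↥(rightBullet U ⊓ leftBullet (starProd V W)) *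
        ellCard ℓ ↥(rightBullet V ⊓ leftBullet W) := by
  unfold ellCard
  rw [← map_mul, ← map_mul]
  exact congrArg ℓ (PNat.eq (card_bullet_identity U V W))

/-- The cocycle `σ` on the subgroup category: for `U ≤ F × G` and `V ≤ G × H`, the value
`σ (U, V)` is `ℓ` at the order of `{g | (1, g) ∈ U} ∩ {g | (g, 1) ∈ V}`. -/
noncomputable def sigmaCocycle {𝕂 : Type v} [Field 𝕂] (ℓ : ℕ+ →* 𝕂ˣ)
    (𝒦 : Set FiniteGrp.{u}) : TwistingCocycle 𝕂 (SubgroupCat 𝒦) where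
  val {F G H} (U : Subgroup (F.grp × G.grp)) (V : Subgroup (G.grp × H.grp)) :=
    ellCard ℓ ↥(rightBullet U ⊓ leftBullet V)
  cocycle {E F G H} (U : Subgroup (E.grp × F.grp)) (V : Subgroup (F.grp × G.grp))
      (W : Subgroup (G.grp × H.grp)) := ellCard_identity ℓ U V W

/-- The algebra `Λ` over `𝕂` determined by `ℓ` and `𝒦`: the twisted category algebra,
associated with `σ`, of the subgroup category on `𝒦`. -/
abbrev LambdaAlgebra {𝕂 : Type v} [Field 𝕂] (ℓ : ℕ+ →* 𝕂ˣ) (𝒦 : Set FiniteGrp.{u}) :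
    Type (max (u + 1) v) :=
  TwistedCategoryAlgebra (sigmaCocycle ℓ 𝒦)

/-- The primes that divide the order of some group in `𝒦`. -/
def primeDivisors (𝒦 : Set FiniteGrp.{u}) : Set Nat.Primes :=
  {q | ∃ R ∈ 𝒦, (q : ℕ) ∣ Nat.card R}

/-- `ℓ` is algebraically independent with respect to `𝒦` when the family of the `ℓ(q)`, with `q`
running over the prime divisors of the orders of the groups in `𝒦`, is algebraically
independent over `ℚ`. -/
def AlgIndepWithRespectTo {𝕂 : Type v} [Field 𝕂] [CharZero 𝕂] (ℓ : ℕ+ →* 𝕂ˣ)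
    (𝒦 : Set FiniteGrp.{u}) : Prop :=
  AlgebraicIndependent ℚ fun q : primeDivisors 𝒦 => ((ℓ (q.1 : ℕ+) : 𝕂ˣ) : 𝕂)

/-!
The algebra is the directed union of the corners of the finite sets `S` of objects, so it is locally
unital, and a corner `e Λ e` is contained in the finite dimensional corner of some `S`
(`TwistedCategoryAlgebra.isLocallyUnital`, `TwistedCategoryAlgebra.exists_unitOn_mul_mul`).
Such a corner `e Λ e` is semisimple once the trace form `(x, y) ↦ tr (x y)` of the left regular
representation of the corner of `S` is nondegenerate: the Jacobson radical of `e Λ e` is nilpotent,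
so it is orthogonal to everything, and hence zero
(`TwistedCategoryAlgebra.isSemisimpleRing_corner`).

The discriminant of the trace form is a polynomial, with rational coefficients and not depending
on `ℓ`, in the values `ℓ q` at the primes `q`. By algebraic independence it is therefore enough to
find a single specialization, over `ℝ`, at which it does not vanish
(`TwistedCategoryAlgebra.traceGram_det_ne_zero_of_algebraicIndependent`).

The specialization is `ℓ n = n ^ d` with `d` large. Give the span of the morphisms within `S` the
bilinear form whose value at two morphisms is `|U ∩ V| ^ d`, where the intersection of nonparallel
morphisms is empty. This is the number of `d`-tuples which lie in both `U` and `V`. If every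
`U` is the set of members of a `d`-tuple, then the incidence matrix between morphisms and tuples
has independent rows, so the form is an inner product
(`tupleIncidence_vecMul_injective`). Counting triples `(f, g, h)` with `(f, g) ∈ U`, `(g, h) ∈ V`
and `(f, h) ∈ W` in two ways shows that left multiplication by the opposite of `U` is the adjoint
of left multiplication by `U` (`SubgroupCat.mulMatrix_opMor`). So `tr (x x*)` is the square of a
norm of left multiplication by `x`, and the trace form is nondegenerate.
-/

/-! ### Units and left multiplication in twisted category algebras -/

namespace TwistingCocycle

variable {𝕂 : Type w} [Field 𝕂] {C : Type u} [Category.{v} C] (γ : TwistingCocycle 𝕂 C)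

theorem val_id_right {X Y : C} (θ : Y ⟶ X) : γ.val θ (𝟙 Y) = γ.val (𝟙 Y) (𝟙 Y) := by
  simpa using γ.cocycle θ (𝟙 Y) (𝟙 Y)

theorem val_id_left {X Y : C} (θ : Y ⟶ X) : γ.val (𝟙 X) θ = γ.val (𝟙 X) (𝟙 X) := by
  simpa using (γ.cocycle (𝟙 X) (𝟙 X) θ).symm

end TwistingCocycle

/-- The morphisms of `C` whose codomain and domain both lie in `S`. -/
abbrev MorWithin {C : Type u} [Category.{v} C] (S : Finset C) : Type (max u v) :=
  {a : Mor C // a.cod ∈ S ∧ a.dom ∈ S}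

instance {C : Type u} [Category.{v} C] [∀ X Y : C, Finite (X ⟶ Y)] (S : Finset C) :
    Finite (MorWithin S) :=
  Finite.of_surjective
    (fun p : Σ (X : S) (Y : S), (Y.1 ⟶ X.1) =>
      (⟨⟨p.1, p.2.1, p.2.2⟩, p.1.2, p.2.1.2⟩ : MorWithin S))
    fun ⟨⟨X, Y, θ⟩, hX, hY⟩ => ⟨⟨⟨X, hX⟩, ⟨Y, hY⟩, θ⟩, rfl⟩

namespace TwistedCategoryAlgebra

variable {𝕂 : Type w} [Field 𝕂] {C : Type u} [Category.{v} C] (γ : TwistingCocycle 𝕂 C)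

/-- The sum of the identity elements of the objects in `S`. The cocycle need not be normalized,
so the identity element of `X` is a multiple of the basis element given by `𝟙 X`. -/
noncomputable def unitOn (S : Finset C) : TwistedCategoryAlgebra γ :=
  ∑ X ∈ S, ((γ.val (𝟙 X) (𝟙 X) : 𝕂ˣ) : 𝕂)⁻¹ • basisElem γ ⟨X, X, 𝟙 X⟩

open Classical in
theorem basisElem_mul_unitOn (S : Finset C) (a : Mor C) :
    basisElem γ a * unitOn γ S = if a.dom ∈ S then basisElem γ a else 0 := by
  obtain ⟨X, Y, θ⟩ := a
  rw [unitOn, Finset.mul_sum]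
  have key : ∀ Z ∈ S, basisElem γ ⟨X, Y, θ⟩ *
      (((γ.val (𝟙 Z) (𝟙 Z) : 𝕂ˣ) : 𝕂)⁻¹ • basisElem γ ⟨Z, Z, 𝟙 Z⟩) =
      if Y = Z then basisElem γ ⟨X, Y, θ⟩ else 0 := by
    intro Z _
    rw [TwistedCategoryAlgebra.mul_smul']
    split_ifs with h
    · subst h
      rw [basisElem_mul_of_comp, γ.val_id_right θ, smul_smul, inv_mul_cancel₀ (Units.ne_zero _),
        one_smul, Category.id_comp]
    · rw [basisElem_mul_of_ne γ _ _ (Ne.symm h), smul_zero]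
  rw [Finset.sum_congr rfl key, Finset.sum_ite_eq]

open Classical in
theorem unitOn_mul_basisElem (S : Finset C) (a : Mor C) :
    unitOn γ S * basisElem γ a = if a.cod ∈ S then basisElem γ a else 0 := by
  obtain ⟨X, Y, θ⟩ := a
  rw [unitOn, Finset.sum_mul]
  have key : ∀ Z ∈ S, (((γ.val (𝟙 Z) (𝟙 Z) : 𝕂ˣ) : 𝕂)⁻¹ • basisElem γ ⟨Z, Z, 𝟙 Z⟩) *
      basisElem γ ⟨X, Y, θ⟩ = if X = Z then basisElem γ ⟨X, Y, θ⟩ else 0 := by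
    intro Z _
    rw [TwistedCategoryAlgebra.smul_mul]
    split_ifs with h
    · subst h
      rw [basisElem_mul_of_comp, γ.val_id_left θ, smul_smul, inv_mul_cancel₀ (Units.ne_zero _),
        one_smul, Category.comp_id]
    · rw [basisElem_mul_of_ne γ _ _ h, smul_zero]
  rw [Finset.sum_congr rfl key, Finset.sum_ite_eq]

theorem isIdempotentElem_unitOn (S : Finset C) : IsIdempotentElem (unitOn γ S) := by
  have h : ∀ X ∈ S, (((γ.val (𝟙 X) (𝟙 X) : 𝕂ˣ) : 𝕂)⁻¹ • basisElem γ ⟨X, X, 𝟙 X⟩) *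
      unitOn γ S = ((γ.val (𝟙 X) (𝟙 X) : 𝕂ˣ) : 𝕂)⁻¹ • basisElem γ ⟨X, X, 𝟙 X⟩ := by
    intro X hX
    rw [TwistedCategoryAlgebra.smul_mul, basisElem_mul_unitOn, if_pos hX]
  unfold IsIdempotentElem
  conv_lhs => rw [unitOn.eq_def (γ := γ) (S := S), Finset.sum_mul]
  exact Finset.sum_congr rfl h

variable {γ} in
/-- Every element lies in the corner of all sufficiently large finite sets of objects. -/
theorem exists_unitOn_mul_mul (x : TwistedCategoryAlgebra γ) :
    ∃ S : Finset C, ∀ T, S ⊆ T → unitOn γ T * x = x ∧ x * unitOn γ T = x := by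
  classical
  induction x using induction_basis with
  | zero => exact ⟨∅, fun T _ => ⟨mul_zero _, zero_mul _⟩⟩
  | add y z hy hz =>
    obtain ⟨S₁, h₁⟩ := hy
    obtain ⟨S₂, h₂⟩ := hz
    refine ⟨S₁ ∪ S₂, fun T hT => ?_⟩
    have k₁ := h₁ T (Finset.union_subset_left hT)
    have k₂ := h₂ T (Finset.union_subset_right hT)
    rw [mul_add, add_mul, k₁.1, k₁.2, k₂.1, k₂.2]
    exact ⟨rfl, rfl⟩
  | smul c a =>
    refine ⟨{a.cod, a.dom}, fun T hT => ?_⟩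
    have h₁ : a.cod ∈ T := hT (by simp)
    have h₂ : a.dom ∈ T := hT (by simp)
    rw [TwistedCategoryAlgebra.mul_smul', TwistedCategoryAlgebra.smul_mul, unitOn_mul_basisElem,
      basisElem_mul_unitOn, if_pos h₁, if_pos h₂]
    exact ⟨rfl, rfl⟩

theorem isLocallyUnital : IsLocallyUnital (TwistedCategoryAlgebra γ) := by
  classical
  intro s
  choose S hS using fun x : TwistedCategoryAlgebra γ => exists_unitOn_mul_mul x
  refine ⟨unitOn γ (s.biUnion S), isIdempotentElem_unitOn γ _, fun a ha => ⟨a, ?_⟩⟩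
  obtain ⟨h₁, h₂⟩ := hS a _ (Finset.subset_biUnion_of_mem S ha)
  rw [h₁, h₂]

variable (S : Finset C)

/-- The matrix of left multiplication by `z` on the span of the morphisms within `S`, followed by
the projection onto that span. -/
noncomputable def mulMatrix :
    TwistedCategoryAlgebra γ →ₗ[𝕂] Matrix (MorWithin S) (MorWithin S) 𝕂 where
  toFun z := Matrix.of fun i j => (morBasis γ).repr (z * basisElem γ j.1) i.1
  map_add' y z := by ext; simp [add_mul]
  map_smul' c z := by ext; simp [TwistedCategoryAlgebra.smul_mul]

theorem mulMatrix_apply (z : TwistedCategoryAlgebra γ) (i j : MorWithin S) :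
    mulMatrix γ S z i j = (morBasis γ).repr (z * basisElem γ j.1) i.1 := rfl

variable [Fintype (MorWithin S)]

variable {γ} in
/-- Compressing by the unit of `S` cuts an element down to its coefficients at the morphisms
within `S`. -/
theorem unitOn_mul_mul_unitOn (x : TwistedCategoryAlgebra γ) :
    unitOn γ S * x * unitOn γ S =
      ∑ k : MorWithin S, (morBasis γ).repr x k.1 • basisElem γ k.1 := by
  classical
  induction x using induction_basis with
  | zero => simp
  | add y z hy hz => simp only [mul_add, add_mul, hy, hz, map_add, Finsupp.add_apply, add_smul,
      Finset.sum_add_distrib]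
  | smul c a =>
    have h : ∀ k : MorWithin S, (morBasis γ).repr (c • basisElem γ a) k.1 • basisElem γ k.1 =
        if a = k.1 then c • basisElem γ a else 0 := by
      intro k
      rw [basisElem, map_smul, Module.Basis.repr_self, Finsupp.smul_apply, Finsupp.single_apply]
      split_ifs with hk
      · rw [smul_eq_mul, mul_one, hk, basisElem]
      · rw [smul_zero, zero_smul]
    rw [Finset.sum_congr rfl fun k _ => h k, TwistedCategoryAlgebra.mul_smul',
      TwistedCategoryAlgebra.smul_mul, unitOn_mul_basisElem]
    by_cases ha : a.cod ∈ S ∧ a.dom ∈ S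
    · rw [if_pos ha.1, basisElem_mul_unitOn, if_pos ha.2,
        Finset.sum_eq_single (⟨a, ha⟩ : MorWithin S), if_pos rfl]
      · exact fun k _ hk => if_neg fun h => hk (Subtype.ext h.symm)
      · exact fun h => absurd (Finset.mem_univ _) h
    · rw [Finset.sum_eq_zero fun k _ => if_neg fun h => ha (by rw [h]; exact k.2)]
      split_ifs with h₁
      · rw [basisElem_mul_unitOn, if_neg fun h₂ => ha ⟨h₁, h₂⟩, smul_zero]
      · rw [TwistedCategoryAlgebra.zero_mul', smul_zero]

variable {γ S} in
theorem mulMatrix_mul (z : TwistedCategoryAlgebra γ) {w : TwistedCategoryAlgebra γ}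
    (hw : unitOn γ S * w = w) : mulMatrix γ S (z * w) = mulMatrix γ S z * mulMatrix γ S w := by
  classical
  ext i j
  have h : w * basisElem γ j.1 =
      ∑ k : MorWithin S, (morBasis γ).repr (w * basisElem γ j.1) k.1 • basisElem γ k.1 := by
    rw [← unitOn_mul_mul_unitOn, mul_assoc, mul_assoc, basisElem_mul_unitOn, if_pos j.2.2,
      ← mul_assoc, hw]
  rw [mulMatrix_apply, mul_assoc, h, Matrix.mul_apply, Finset.mul_sum, map_sum,
    Finsupp.finsetSum_apply]
  refine Finset.sum_congr rfl fun k _ => ?_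
  rw [TwistedCategoryAlgebra.mul_smul', map_smul, Finsupp.smul_apply, smul_eq_mul, mul_comm]
  rfl

variable {γ S} in
/-- An element of the corner of `S` is determined by its left multiplication on that corner. -/
theorem eq_zero_of_mulMatrix_eq_zero {x : TwistedCategoryAlgebra γ}
    (h₁ : unitOn γ S * x = x) (h₂ : x * unitOn γ S = x) (h : mulMatrix γ S x = 0) : x = 0 := by
  classical
  have hx : ∀ j : MorWithin S, x * basisElem γ j.1 = 0 := by
    intro j
    have h' := unitOn_mul_mul_unitOn S (x * basisElem γ j.1)
    rw [mul_assoc, mul_assoc, basisElem_mul_unitOn, if_pos j.2.2, ← mul_assoc, h₁] at h'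
    rw [h']
    refine Finset.sum_eq_zero fun k _ => ?_
    rw [← mulMatrix_apply, h, Matrix.zero_apply, zero_smul]
  rw [← h₂, unitOn, Finset.mul_sum]
  refine Finset.sum_eq_zero fun X hX => ?_
  rw [TwistedCategoryAlgebra.mul_smul', hx ⟨⟨X, X, 𝟙 X⟩, hX, hX⟩, smul_zero]

/-- The Gram matrix, with respect to the morphisms within `S`, of the trace form
`(x, y) ↦ tr (x y)` of the left regular representation. -/
noncomputable def traceGram : Matrix (MorWithin S) (MorWithin S) 𝕂 :=
  Matrix.of fun a b => (mulMatrix γ S (basisElem γ a.1) * mulMatrix γ S (basisElem γ b.1)).trace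

variable {γ S} in
theorem mulMatrix_eq_sum {x : TwistedCategoryAlgebra γ}
    (h₁ : unitOn γ S * x = x) (h₂ : x * unitOn γ S = x) :
    mulMatrix γ S x =
      ∑ a : MorWithin S, (morBasis γ).repr x a.1 • mulMatrix γ S (basisElem γ a.1) := by
  conv_lhs => rw [← h₂, ← h₁, unitOn_mul_mul_unitOn]
  rw [map_sum]
  exact Finset.sum_congr rfl fun a _ => map_smul _ _ _

open Classical in
variable {γ S} in
/-- When the Gram matrix is invertible, the trace form is nondegenerate on the corner of `S`. -/
theorem eq_zero_of_trace_eq_zero (hdet : (traceGram γ S).det ≠ 0) {x : TwistedCategoryAlgebra γ}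
    (h₁ : unitOn γ S * x = x) (h₂ : x * unitOn γ S = x)
    (h : ∀ b : MorWithin S, (mulMatrix γ S x * mulMatrix γ S (basisElem γ b.1)).trace = 0) :
    x = 0 := by
  have hv : Matrix.vecMul (fun a : MorWithin S => (morBasis γ).repr x a.1) (traceGram γ S) = 0 := by
    funext b
    rw [Pi.zero_apply, ← h b, mulMatrix_eq_sum h₁ h₂, Finset.sum_mul, Matrix.trace_sum]
    refine Finset.sum_congr rfl fun a _ => ?_
    rw [smul_mul_assoc, Matrix.trace_smul, smul_eq_mul]
    rfl
  have h0 := Matrix.eq_zero_of_vecMul_eq_zero hdet hv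
  rw [← h₂, ← h₁, unitOn_mul_mul_unitOn]
  exact Finset.sum_eq_zero fun a _ => by rw [show (morBasis γ).repr x a.1 = 0 from congrFun h0 a,
    zero_smul]

open Classical in
/-- A corner contained in that of `S` is finite dimensional; its Jacobson radical is nilpotent,
hence orthogonal to everything for the trace form, hence zero. -/
theorem isSemisimpleRing_corner (hdet : (traceGram γ S).det ≠ 0) {e : TwistedCategoryAlgebra γ}
    (he : IsIdempotentElem e) (h₁ : unitOn γ S * e = e) (h₂ : e * unitOn γ S = e) :
    IsSemisimpleRing he.Corner := by
  have val_mul : ∀ x y : he.Corner, (x * y).1 = x.1 * y.1 := fun _ _ => rfl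
  have eL : ∀ x : he.Corner, e * x.1 = x.1 := fun x => ((Subsemigroup.mem_corner_iff he).1 x.2).1
  have eR : ∀ x : he.Corner, x.1 * e = x.1 := fun x => ((Subsemigroup.mem_corner_iff he).1 x.2).2
  have uL : ∀ x : he.Corner, unitOn γ S * x.1 = x.1 := fun x => by
    rw [← eL x, ← mul_assoc, h₁]
  have uR : ∀ x : he.Corner, x.1 * unitOn γ S = x.1 := fun x => by
    rw [← eR x, mul_assoc, h₂]
  let _ : SMul 𝕂 he.Corner := ⟨fun c x => ⟨c • x.1, c • x.1, by
    change e * (c • x.1) * e = c • x.1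
    rw [TwistedCategoryAlgebra.mul_smul', TwistedCategoryAlgebra.smul_mul, eL, eR]⟩⟩
  let ι : he.Corner →+ TwistedCategoryAlgebra γ :=
    { toFun := Subtype.val, map_zero' := rfl, map_add' := fun _ _ => rfl }
  have hι : Function.Injective ι := Subtype.val_injective
  let _ : Module 𝕂 he.Corner := hι.module 𝕂 ι fun _ _ => rfl
  have _ : IsScalarTower 𝕂 he.Corner he.Corner :=
    ⟨fun c x y => Subtype.ext (TwistedCategoryAlgebra.smul_mul γ c x.1 y.1)⟩
  let L : he.Corner →ₗ[𝕂] Matrix (MorWithin S) (MorWithin S) 𝕂 :=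
    mulMatrix γ S ∘ₗ { ι with map_smul' := fun _ _ => rfl }
  have hL : ∀ x, L x = mulMatrix γ S x.1 := fun _ => rfl
  have hLinj : Function.Injective L := by
    rw [injective_iff_map_eq_zero]
    exact fun x hx => Subtype.ext (eq_zero_of_mulMatrix_eq_zero (uL x) (uR x) hx)
  have _ : Module.Finite 𝕂 he.Corner := Module.Finite.of_injective L hLinj
  have _ : IsArtinianRing he.Corner := IsArtinianRing.of_finite 𝕂 he.Corner
  have hLmul : ∀ x y, L (x * y) = L x * L y := fun x y => mulMatrix_mul x.1 (uL y)
  have hLpow : ∀ (x : he.Corner) (n : ℕ), L (x ^ (n + 1)) = L x ^ (n + 1) := by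
    intro x n
    induction n with
    | zero => rw [zero_add, pow_one, pow_one]
    | succ n ih => rw [pow_succ, hLmul, ih, ← pow_succ]
  rw [IsArtinianRing.isSemisimpleRing_iff_jacobson, eq_bot_iff]
  intro x hx
  obtain ⟨n, hn⟩ := IsSemiprimaryRing.isNilpotent (R := he.Corner)
  refine (Submodule.mem_bot _).2 (Subtype.ext (eq_zero_of_trace_eq_zero hdet (uL x) (uR x) ?_))
  intro b
  let y : he.Corner := ⟨e * basisElem γ b.1 * e, _, rfl⟩
  have hxy : x * y ∈ Ring.jacobson he.Corner := Ideal.mul_mem_right _ _ hx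
  have hnil : IsNilpotent (L (x * y)) := by
    refine ⟨n + 1, ?_⟩
    have h0 : (x * y) ^ n = 0 := by
      have := Ideal.pow_mem_pow hxy n
      rwa [hn] at this
    rw [← hLpow, pow_succ, h0, zero_mul, map_zero]
  have hb : unitOn γ S * basisElem γ b.1 = basisElem γ b.1 := by
    rw [unitOn_mul_basisElem, if_pos b.2.1]
  have hbe : unitOn γ S * (basisElem γ b.1 * e) = basisElem γ b.1 * e := by
    rw [← mul_assoc, hb]
  have ht : (L (x * y)).trace = 0 := (Matrix.isNilpotent_trace_of_isNilpotent hnil).eq_zero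
  -- As `x = e x e`, the trace of `x b` is that of `x y`, with `y = e b e` in the corner of `e`.
  have hxy' : (x * y).1 = x.1 * (basisElem γ b.1 * e) := by
    rw [val_mul]
    change x.1 * (e * basisElem γ b.1 * e) = _
    rw [mul_assoc, ← mul_assoc x.1, eR]
  rw [hL, hxy', mulMatrix_mul _ hbe, mulMatrix_mul _ h₁, ← mul_assoc, Matrix.trace_mul_comm,
    ← mul_assoc, ← mulMatrix_mul _ (uL x), eL] at ht
  exact ht

end TwistedCategoryAlgebra

/-! ### Real matrices with an adjoint -/

section Matrices

open Matrix

variable {ι κ : Type*} [Fintype ι] [Fintype κ]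

/-- The diagonal entries of `B P Bᵀ` are the values of the quadratic form of `P` at the rows. -/
theorem Matrix.PosDef.eq_zero_of_trace_mul_mul_transpose {P : Matrix ι ι ℝ} (hP : P.PosDef)
    {B : Matrix κ ι ℝ} (h : (B * P * Bᵀ).trace = 0) : B = 0 := by
  have hnn : ∀ i, 0 ≤ (B * P * Bᵀ) i i := fun i => by
    have := hP.posSemidef.mul_mul_conjTranspose_same B
    rw [conjTranspose_eq_transpose_of_trivial] at this
    exact this.diag_nonneg
  funext i
  by_contra hi
  have h0 : (B * P * Bᵀ) i i = 0 :=
    (Finset.sum_eq_zero_iff_of_nonneg fun i _ => hnn i).1 h i (Finset.mem_univ i)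
  have hpos := hP.dotProduct_mulVec_pos (x := B i) hi
  rw [star_trivial, dotProduct_mulVec] at hpos
  refine hpos.ne' ?_
  rw [← h0]
  rfl

/-- If `M'` is the adjoint of `M` for the inner product with Gram matrix `A Aᵀ`, then `tr (M M')`
is the square of a norm of `M`. -/
theorem Matrix.eq_zero_of_trace_mul_adjoint {A : Matrix ι κ ℝ}
    (hA : Function.Injective A.vecMul) {M M' : Matrix ι ι ℝ}
    (h : A * Aᵀ * M' = Mᵀ * (A * Aᵀ)) (ht : (M * M').trace = 0) : M = 0 := by
  classical
  have hH : (A * Aᵀ).PosDef := by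
    have := PosDef.mul_conjTranspose_self A hA
    rwa [conjTranspose_eq_transpose_of_trivial] at this
  have hu : IsUnit (A * Aᵀ).det := (isUnit_iff_isUnit_det _).1 hH.isUnit
  have hM' : M' = (A * Aᵀ)⁻¹ * (Mᵀ * (A * Aᵀ)) := by
    rw [← h, nonsing_inv_mul_cancel_left _ _ hu]
  -- `tr (M M') = tr (B (A Aᵀ)⁻¹ Bᵀ)` for `B = Aᵀ M`.
  have h0 : Aᵀ * M = 0 := by
    refine hH.inv.eq_zero_of_trace_mul_mul_transpose ?_
    rw [← ht, hM', transpose_mul, transpose_transpose]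
    simp only [Matrix.mul_assoc]
    rw [trace_mul_comm Aᵀ]
    simp only [Matrix.mul_assoc]
  have h1 : A * Aᵀ * M = 0 := by rw [Matrix.mul_assoc, h0, Matrix.mul_zero]
  rw [← nonsing_inv_mul_cancel_left (A * Aᵀ) M hu, h1, Matrix.mul_zero]

end Matrices

section TupleIncidence

open Matrix

variable {ι Y : Type*} [Fintype Y] [DecidableEq Y]

/-- The incidence matrix between the sets of a family and the tuples of points, indexed by the
points themselves: the entry is `1` when all members of the tuple lie in the set. -/
def tupleIncidence (s : ι → Finset Y) : Matrix ι (Y → Y) ℝ :=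
  Matrix.of fun k u => if ∀ y, u y ∈ s k then 1 else 0

theorem tupleIncidence_mul_transpose (s : ι → Finset Y) (k k' : ι) :
    (tupleIncidence s * (tupleIncidence s)ᵀ) k k' =
      ((s k ∩ s k').card : ℝ) ^ Fintype.card Y := by
  have h : ∀ u : Y → Y, tupleIncidence s k u * (tupleIncidence s)ᵀ u k' =
      if u ∈ Fintype.piFinset fun _ : Y => s k ∩ s k' then 1 else 0 := by
    intro u
    simp only [tupleIncidence, of_apply, transpose_apply, Fintype.mem_piFinset, Finset.mem_inter,
      forall_and, ite_and, mul_ite, mul_one, mul_zero]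
    split_ifs <;> rfl
  rw [mul_apply, Finset.sum_congr rfl fun u _ => h u, Finset.sum_boole,
    Finset.filter_univ_mem, Fintype.card_piFinset, Finset.prod_const, Finset.card_univ,
    Nat.cast_pow]

/-- The rows of the incidence matrix are linearly independent: a tuple that enumerates a set
of the family only meets the rows of the sets containing it, so the matrix is triangular. -/
theorem tupleIncidence_vecMul_injective [Fintype ι] {s : ι → Finset Y} (hs : Function.Injective s)
    (hne : ∀ k, (s k).Nonempty) : Function.Injective (tupleIncidence s).vecMul := by
  intro c₁ c₂ hc
  rw [← sub_eq_zero]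
  replace hc : (c₁ - c₂) ᵥ* tupleIncidence s = 0 := by
    rw [sub_vecMul, sub_eq_zero]
    exact hc
  generalize c₁ - c₂ = c at hc
  by_contra hc0
  obtain ⟨k₀, hk₀⟩ := Function.ne_iff.1 hc0
  classical
  -- A largest set with nonzero coefficient, and a tuple that enumerates it.
  obtain ⟨k, hk, hmax⟩ := Finset.exists_max_image (Finset.univ.filter fun k => c k ≠ 0)
    (fun k => (s k).card) ⟨k₀, by simpa using hk₀⟩
  refine (Finset.mem_filter.1 hk).2 ?_
  obtain ⟨y₀, hy₀⟩ := hne k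
  have h := congrFun hc fun y => if y ∈ s k then y else y₀
  have hinc : ∀ k', tupleIncidence s k' (fun y => if y ∈ s k then y else y₀) =
      if s k ⊆ s k' then 1 else 0 := by
    intro k'
    rw [tupleIncidence, of_apply]
    refine if_congr ⟨fun H y hy => by simpa [hy] using H y, fun H y => ?_⟩ rfl rfl
    dsimp only
    split_ifs with hy
    exacts [H hy, H hy₀]
  rw [vecMul, dotProduct, Finset.sum_eq_single k] at h
  · simpa [hinc] using h
  · intro k' _ hk'
    rw [hinc]
    split_ifs with hsub
    · by_contra hne'
      have hck' : c k' ≠ 0 := fun h0 => hne' (by rw [h0, zero_mul])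
      exact hk' (hs (Finset.eq_of_subset_of_card_le hsub (hmax k' (by simpa using hck')))).symm
    · rw [mul_zero]
  · exact fun h' => absurd (Finset.mem_univ k) h'

end TupleIncidence

/-! ### Counting triples -/

namespace SubgroupCat

variable {𝒦 : Set FiniteGrp.{u}}

instance (F G : SubgroupCat 𝒦) : Finite (F ⟶ G) :=
  inferInstanceAs (Finite (Subgroup (G.grp × F.grp)))

/-- The disjoint union of the groups in `S`. -/
abbrev Points (S : Finset (SubgroupCat 𝒦)) : Type (u + 1) := Σ F : S, F.1.grp

noncomputable instance (S : Finset (SubgroupCat 𝒦)) : Fintype (Points S) := Fintype.ofFinite _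

variable {S : Finset (SubgroupCat 𝒦)}

/-- A morphism `F ← G`, seen as a binary relation on the disjoint union of the groups in `S`. -/
def Rel (a : MorWithin S) (x y : Points S) : Prop :=
  ∃ (f : a.1.cod.grp) (g : a.1.dom.grp),
    (f, g) ∈ (show Subgroup (a.1.cod.grp × a.1.dom.grp) from a.1.hom) ∧
      x = ⟨⟨a.1.cod, a.2.1⟩, f⟩ ∧ y = ⟨⟨a.1.dom, a.2.2⟩, g⟩

theorem rel_mk_iff {F G : SubgroupCat 𝒦} {hF : F ∈ S} {hG : G ∈ S}
    {U : Subgroup (F.grp × G.grp)} {f : F.grp} {g : G.grp} :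
    Rel (S := S) ⟨⟨F, G, U⟩, hF, hG⟩ ⟨⟨F, hF⟩, f⟩ ⟨⟨G, hG⟩, g⟩ ↔ (f, g) ∈ U := by
  constructor
  · rintro ⟨f', g', h, hx, hy⟩
    cases hx
    cases hy
    exact h
  · exact fun h => ⟨f, g, h, rfl, rfl⟩

open Classical in
/-- The set of the pairs related by a morphism. -/
noncomputable def graph (a : MorWithin S) : Finset (Points S × Points S) :=
  Finset.univ.filter fun p => Rel a p.1 p.2

theorem mem_graph {a : MorWithin S} {x y : Points S} : (x, y) ∈ graph a ↔ Rel a x y := by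
  simp [graph]

theorem graph_nonempty (a : MorWithin S) : (graph a).Nonempty :=
  ⟨(⟨⟨a.1.cod, a.2.1⟩, 1⟩, ⟨⟨a.1.dom, a.2.2⟩, 1⟩),
    mem_graph.2 ⟨1, 1, Subgroup.one_mem _, rfl, rfl⟩⟩

theorem graph_injective : Function.Injective (graph (S := S)) := by
  intro a b hab
  have key : ∀ x y, Rel a x y ↔ Rel b x y := fun x y => by rw [← mem_graph, hab, mem_graph]
  obtain ⟨⟨F, G, U⟩, hF, hG⟩ := a
  obtain ⟨⟨F', G', V⟩, hF', hG'⟩ := b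
  -- The pair of identity elements determines the codomain and the domain.
  obtain ⟨f, g, -, hx, hy⟩ :=
    (key ⟨⟨F, hF⟩, 1⟩ ⟨⟨G, hG⟩, 1⟩).1 ⟨1, 1, Subgroup.one_mem _, rfl, rfl⟩
  obtain rfl : F = F' := congrArg (fun x : Points S => x.1.1) hx
  obtain rfl : G = G' := congrArg (fun x : Points S => x.1.1) hy
  have hUV : U = V := by
    refine Subgroup.ext (G := F.grp × G.grp) fun p => ?_
    exact rel_mk_iff.symm.trans ((key ⟨⟨F, hF⟩, p.1⟩ ⟨⟨G, hG⟩, p.2⟩).trans rel_mk_iff)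
  subst hUV
  rfl

/-- The opposite `{(g, f) | (f, g) ∈ U}` of a morphism `U`. -/
def opMor (a : MorWithin S) : MorWithin S :=
  ⟨⟨a.1.dom, a.1.cod,
    (show Subgroup (a.1.cod.grp × a.1.dom.grp) from a.1.hom).comap
      (MulEquiv.prodComm : a.1.dom.grp × a.1.cod.grp ≃* _).toMonoidHom⟩, a.2.2, a.2.1⟩

theorem rel_opMor {a : MorWithin S} {x y : Points S} : Rel (opMor a) x y ↔ Rel a y x :=
  ⟨fun ⟨f, g, h, hx, hy⟩ => ⟨g, f, h, hy, hx⟩, fun ⟨f, g, h, hx, hy⟩ => ⟨g, f, h, hy, hx⟩⟩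

open Classical in
/-- The number of triples `(x, y, z)` with `(x, y) ∈ a`, `(y, z) ∈ b` and `(x, z) ∈ c`. -/
noncomputable def tripleCount (a b c : MorWithin S) : ℕ :=
  ∑ x : Points S, ∑ y : Points S, ∑ z : Points S,
    if Rel a x y ∧ Rel b y z ∧ Rel c x z then 1 else 0

/-- Exchange the roles of `x` and `y`. -/
theorem tripleCount_opMor (a b c : MorWithin S) :
    tripleCount (opMor a) c b = tripleCount a b c := by
  classical
  unfold tripleCount
  rw [Finset.sum_comm]
  refine Finset.sum_congr rfl fun x _ => Finset.sum_congr rfl fun y _ =>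
    Finset.sum_congr rfl fun z _ => if_congr ?_ rfl rfl
  rw [rel_opMor]
  tauto

theorem tripleCount_eq_zero {a b : MorWithin S} (h : b.1.cod ≠ a.1.dom) (c : MorWithin S) :
    tripleCount a b c = 0 := by
  classical
  refine Finset.sum_eq_zero fun x _ => Finset.sum_eq_zero fun y _ =>
    Finset.sum_eq_zero fun z _ => if_neg ?_
  rintro ⟨⟨f, g, -, -, h₁⟩, ⟨g', k, -, h₂, -⟩, -⟩
  exact h (congrArg (fun x : Points S => x.1.1) (h₂.symm.trans h₁))

open Classical in
/-- For related `x` and `z`, the possible middle points form a coset of `U_• ∩ •V`. -/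
theorem card_middle {F G H : SubgroupCat 𝒦} (hF : F ∈ S) (hG : G ∈ S) (hH : H ∈ S)
    (U : Subgroup (F.grp × G.grp)) (V : Subgroup (G.grp × H.grp)) (x z : Points S) :
    (Finset.univ.filter fun y => Rel (S := S) ⟨⟨F, G, U⟩, hF, hG⟩ x y ∧
        Rel (S := S) ⟨⟨G, H, V⟩, hG, hH⟩ y z).card =
      if Rel (S := S) ⟨⟨F, H, starProd U V⟩, hF, hH⟩ x z then
        Nat.card ↥(rightBullet U ⊓ leftBullet V) else 0 := by
  split_ifs with hxz
  · obtain ⟨f, h, ⟨g₀, hU, hV⟩, rfl, rfl⟩ := hxz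
    dsimp only at f h g₀ hU hV
    have : Fintype ↥(rightBullet U ⊓ leftBullet V) := Fintype.ofFinite _
    have hinj : Function.Injective fun n : ↥(rightBullet U ⊓ leftBullet V) =>
        (⟨⟨G, hG⟩, g₀ * n.1⟩ : Points S) := by
      intro n m hnm
      have h' : g₀ * n.1 = g₀ * m.1 := by simpa using hnm
      exact Subtype.ext (mul_left_cancel h')
    rw [Nat.card_eq_fintype_card, ← Finset.card_univ, ← Finset.card_image_of_injective _ hinj]
    congr 1
    ext y
    simp only [Finset.mem_filter, Finset.mem_univ, true_and, Finset.mem_image]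
    constructor
    · rintro ⟨⟨f', g, h₁, hx, rfl⟩, h₂⟩
      cases hx
      have h₂ := rel_mk_iff.1 h₂
      refine ⟨⟨g₀⁻¹ * g, ?_, ?_⟩, ?_⟩
      · have := U.mul_mem (U.inv_mem hU) h₁
        simpa [mem_rightBullet] using this
      · have := V.mul_mem (V.inv_mem hV) h₂
        simpa [mem_leftBullet] using this
      · simp
    · rintro ⟨⟨n, hn₁, hn₂⟩, rfl⟩
      refine ⟨rel_mk_iff.2 ?_, rel_mk_iff.2 ?_⟩
      · simpa using U.mul_mem hU (mem_rightBullet.1 hn₁)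
      · simpa using V.mul_mem hV (mem_leftBullet.1 hn₂)
  · rw [Finset.card_eq_zero, Finset.filter_eq_empty_iff]
    rintro y - ⟨⟨f, g, hU, rfl, rfl⟩, g', h, hV, hy, rfl⟩
    cases hy
    exact hxz ⟨f, h, ⟨g, hU, hV⟩, rfl, rfl⟩

open Classical in
theorem tripleCount_eq_mul {F G H : SubgroupCat 𝒦} (hF : F ∈ S) (hG : G ∈ S) (hH : H ∈ S)
    (U : Subgroup (F.grp × G.grp)) (V : Subgroup (G.grp × H.grp)) (c : MorWithin S) :
    tripleCount (S := S) ⟨⟨F, G, U⟩, hF, hG⟩ ⟨⟨G, H, V⟩, hG, hH⟩ c =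
      Nat.card ↥(rightBullet U ⊓ leftBullet V) *
        (graph (S := S) ⟨⟨F, H, starProd U V⟩, hF, hH⟩ ∩ graph c).card := by
  have h : ∀ x z : Points S, (∑ y : Points S, if Rel (S := S) ⟨⟨F, G, U⟩, hF, hG⟩ x y ∧
      Rel (S := S) ⟨⟨G, H, V⟩, hG, hH⟩ y z ∧ Rel c x z then 1 else 0) =
      if (x, z) ∈ graph (S := S) ⟨⟨F, H, starProd U V⟩, hF, hH⟩ ∩ graph c then
        Nat.card ↥(rightBullet U ⊓ leftBullet V) else 0 := by
    intro x z
    simp only [Finset.mem_inter, mem_graph]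
    by_cases hc : Rel c x z
    · simp only [hc, and_true]
      rw [← card_middle hF hG hH U V x z, Finset.sum_boole, Nat.cast_id]
    · simp [hc]
  unfold tripleCount
  rw [Finset.sum_congr rfl fun x _ => Finset.sum_comm,
    Finset.sum_congr rfl fun x _ => Finset.sum_congr rfl fun z _ => h x z,
    ← Fintype.sum_prod_type' (f := fun x z => if (x, z) ∈ graph (S := S)
      ⟨⟨F, H, starProd U V⟩, hF, hH⟩ ∩ graph c then
        Nat.card ↥(rightBullet U ⊓ leftBullet V) else 0)]
  rw [← Finset.sum_filter, Finset.sum_const, smul_eq_mul, mul_comm, Finset.filter_univ_mem]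

end SubgroupCat

/-! ### The specialization at powers -/

/-- The homomorphism `n ↦ n ^ d`. -/
noncomputable def pnatPowHom (d : ℕ) : ℕ+ →* ℝˣ where
  toFun n := Units.mk0 ((n : ℝ) ^ d) (pow_ne_zero _ (Nat.cast_ne_zero.2 n.ne_zero))
  map_one' := by ext; simp
  map_mul' m n := by ext; simp [mul_pow]

namespace SubgroupCat

open TwistedCategoryAlgebra

variable {𝒦 : Set FiniteGrp.{u}} {S : Finset (SubgroupCat 𝒦)} [Fintype (MorWithin S)]

open Classical in
/-- The inner product of `a b` with `c`. Because `σ` takes the value `|U_• ∩ •V| ^ d`, the two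
factors combine to a power of a number of triples. -/
theorem sum_mulMatrix_mul_card_pow {d : ℕ} (hd : d ≠ 0) (a b c : MorWithin S) :
    ∑ i : MorWithin S, mulMatrix (sigmaCocycle (pnatPowHom d) 𝒦) S (basisElem _ a.1) i b *
      ((graph i ∩ graph c).card : ℝ) ^ d = (tripleCount a b c : ℝ) ^ d := by
  obtain ⟨⟨F, G, U⟩, hF, hG⟩ := a
  obtain ⟨⟨G', H, V⟩, hG', hH⟩ := b
  by_cases h : G' = G
  · subst h
    rw [tripleCount_eq_mul hF hG' hH, Finset.sum_eq_single
      (⟨⟨F, H, starProd U V⟩, hF, hH⟩ : MorWithin S)]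
    · rw [mulMatrix_apply, basisElem_mul_of_comp, map_smul, basisElem, Module.Basis.repr_self,
        Finsupp.smul_apply, smul_eq_mul, Finsupp.single_apply]
      rw [if_pos, mul_one, Nat.cast_mul, mul_pow] <;> rfl
    · intro i _ hi
      rw [mulMatrix_apply, basisElem_mul_of_comp, map_smul, basisElem, Module.Basis.repr_self,
        Finsupp.smul_apply, Finsupp.single_eq_of_ne, smul_zero, zero_mul]
      exact fun h => hi (Subtype.ext h)
    · exact fun h => absurd (Finset.mem_univ _) h
  · rw [tripleCount_eq_zero h, Nat.cast_zero, zero_pow hd]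
    refine Finset.sum_eq_zero fun i _ => ?_
    rw [mulMatrix_apply, basisElem_mul_of_ne _ _ _ h, map_zero, Finsupp.zero_apply, zero_mul]

open Classical in
variable (S) in
/-- The incidence matrix between the graphs of the morphisms within `S` and the tuples of
pairs of points. -/
noncomputable def graphIncidence :
    Matrix (MorWithin S) (Points S × Points S → Points S × Points S) ℝ :=
  tupleIncidence graph

open Classical in
/-- With respect to the inner product for which the product of two morphisms is a power of the
number of pairs they share, left multiplication by the opposite of a morphism is the adjoint of
left multiplication by the morphism: both sides count triples. -/
theorem mulMatrix_opMor {d : ℕ} (hd : d = Fintype.card (Points S × Points S)) (hd0 : d ≠ 0)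
    (a : MorWithin S) :
    graphIncidence S * (graphIncidence S).transpose *
        mulMatrix (sigmaCocycle (pnatPowHom d) 𝒦) S (basisElem _ (opMor a).1) =
      (mulMatrix (sigmaCocycle (pnatPowHom d) 𝒦) S (basisElem _ a.1)).transpose *
        (graphIncidence S * (graphIncidence S).transpose) := by
  have hH : ∀ i j : MorWithin S, (graphIncidence S * (graphIncidence S).transpose) i j =
      ((graph i ∩ graph j).card : ℝ) ^ d := fun i j => by
    rw [graphIncidence, tupleIncidence_mul_transpose, hd]
  ext k j
  rw [Matrix.mul_apply, Matrix.mul_apply]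
  simp only [hH, Matrix.transpose_apply]
  rw [sum_mulMatrix_mul_card_pow hd0, ← tripleCount_opMor, ← sum_mulMatrix_mul_card_pow hd0]
  refine Finset.sum_congr rfl fun i _ => ?_
  rw [mul_comm, Finset.inter_comm]

open Classical in
/-- The exponent, which is also the length of the tuples, is the number of all pairs of points, so
that each graph can be enumerated by a tuple. -/
theorem traceGram_pnatPowHom_det_ne_zero {d : ℕ}
    (hd : d = Fintype.card (Points S × Points S)) :
    (traceGram (sigmaCocycle (pnatPowHom d) 𝒦) S).det ≠ 0 := by
  rw [Ne, ← Matrix.exists_vecMul_eq_zero_iff]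
  rintro ⟨v, hv0, hv⟩
  obtain ⟨k₀, hk₀⟩ := Function.ne_iff.1 hv0
  have hd0 : d ≠ 0 := by
    obtain ⟨p, -⟩ := graph_nonempty k₀
    rw [hd]
    have _ : Nonempty (Points S × Points S) := ⟨p⟩
    exact Fintype.card_ne_zero
  set γ := sigmaCocycle (pnatPowHom d) 𝒦
  let x : TwistedCategoryAlgebra γ := ∑ a : MorWithin S, v a • basisElem γ a.1
  let M : Matrix (MorWithin S) (MorWithin S) ℝ :=
    ∑ a : MorWithin S, v a • mulMatrix γ S (basisElem γ a.1)
  let M' : Matrix (MorWithin S) (MorWithin S) ℝ :=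
    ∑ a : MorWithin S, v a • mulMatrix γ S (basisElem γ (opMor a).1)
  have hxM : mulMatrix γ S x = M := by
    rw [map_sum]
    exact Finset.sum_congr rfl fun a _ => map_smul _ _ _
  have hadj : graphIncidence S * (graphIncidence S).transpose * M' =
      M.transpose * (graphIncidence S * (graphIncidence S).transpose) := by
    rw [Finset.mul_sum, Matrix.transpose_sum, Finset.sum_mul]
    refine Finset.sum_congr rfl fun a _ => ?_
    rw [Matrix.mul_smul, Matrix.transpose_smul, Matrix.smul_mul, mulMatrix_opMor hd hd0]
  have htr : ∀ b : MorWithin S, (M * mulMatrix γ S (basisElem γ b.1)).trace = 0 := by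
    intro b
    rw [← Pi.zero_apply (M := fun _ : MorWithin S => ℝ) b, ← hv, Finset.sum_mul, Matrix.trace_sum]
    refine Finset.sum_congr rfl fun a _ => ?_
    rw [Matrix.smul_mul, Matrix.trace_smul, smul_eq_mul]
    rfl
  -- `M` and its adjoint `M'` come from `x` and `x*`, and `x` is in the radical of the form.
  have hM : M = 0 := by
    refine Matrix.eq_zero_of_trace_mul_adjoint
      (tupleIncidence_vecMul_injective graph_injective graph_nonempty) hadj ?_
    rw [Finset.mul_sum, Matrix.trace_sum]
    refine Finset.sum_eq_zero fun a _ => ?_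
    rw [Matrix.mul_smul, Matrix.trace_smul, htr, smul_zero]
  have hx : x = 0 := by
    refine eq_zero_of_mulMatrix_eq_zero (S := S) ?_ ?_ (hxM.trans hM)
    · rw [Finset.mul_sum]
      refine Finset.sum_congr rfl fun a _ => ?_
      rw [TwistedCategoryAlgebra.mul_smul', unitOn_mul_basisElem, if_pos a.2.1]
    · rw [Finset.sum_mul]
      refine Finset.sum_congr rfl fun a _ => ?_
      rw [TwistedCategoryAlgebra.smul_mul, basisElem_mul_unitOn, if_pos a.2.2]
  have hli := (morBasis γ).linearIndependent.comp (Subtype.val : MorWithin S → Mor _)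
    Subtype.val_injective
  exact hk₀ (Fintype.linearIndependent_iff.1 hli v hx k₀)

end SubgroupCat

/-! ### Transfer of the discriminant -/

namespace TwistedCategoryAlgebra

variable {𝕂 : Type v} [Field 𝕂] [CharZero 𝕂]

/-- Evaluation of polynomials in variables indexed by the prime divisors, at the values of `ℓ`
and of `ℓ'` simultaneously. -/
noncomputable def evalPair (ℓ : ℕ+ →* 𝕂ˣ) (ℓ' : ℕ+ →* ℝˣ) (𝒦 : Set FiniteGrp.{u}) :
    MvPolynomial (primeDivisors 𝒦) ℚ →ₐ[ℚ] 𝕂 × ℝ :=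
  MvPolynomial.aeval fun q => (((ℓ (q.1 : ℕ+) : 𝕂ˣ) : 𝕂), ((ℓ' (q.1 : ℕ+) : ℝˣ) : ℝ))

variable (ℓ : ℕ+ →* 𝕂ˣ) (ℓ' : ℕ+ →* ℝˣ) {𝒦 : Set FiniteGrp.{u}}

theorem mem_range_evalPair_of_dvd (n : ℕ) : ∀ hn : 0 < n,
    (∀ q : Nat.Primes, (q : ℕ) ∣ n → q ∈ primeDivisors 𝒦) →
    (((ℓ (Nat.toPNat n hn) : 𝕂ˣ) : 𝕂), ((ℓ' (Nat.toPNat n hn) : ℝˣ) : ℝ)) ∈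
      (evalPair ℓ ℓ' 𝒦).range := by
  induction n using induction_on_primes with
  | zero => exact fun hn => absurd hn (lt_irrefl 0)
  | one =>
    intro hn _
    have h1 : Nat.toPNat 1 hn = 1 := rfl
    rw [h1, map_one, map_one]
    exact one_mem _
  | prime_mul p n hp ih =>
    intro hn h
    have hn' : 0 < n := Nat.pos_of_mul_pos_left hn
    have hmul : Nat.toPNat (p * n) hn = Nat.toPNat p hp.pos * Nat.toPNat n hn' := rfl
    rw [hmul, map_mul, map_mul, Units.val_mul, Units.val_mul, ← Prod.mk_mul_mk]
    refine mul_mem ?_ (ih hn' fun q hq => h q (hq.mul_left p))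
    exact ⟨MvPolynomial.X ⟨⟨p, hp⟩, h ⟨p, hp⟩ (Dvd.intro n rfl)⟩, MvPolynomial.aeval_X _ _⟩

theorem ellCard_mem_range_evalPair (G : SubgroupCat 𝒦) (K : Subgroup G.grp) :
    (((ellCard ℓ K : 𝕂ˣ) : 𝕂), ((ellCard ℓ' K : ℝˣ) : ℝ)) ∈ (evalPair ℓ ℓ' 𝒦).range :=
  mem_range_evalPair_of_dvd ℓ ℓ' _ Nat.card_pos fun _ hq =>
    ⟨G.grp, G.mem, hq.trans K.card_subgroup_dvd_card⟩

variable (S : Finset (SubgroupCat 𝒦))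

theorem mulMatrix_mem_range_evalPair (a i j : MorWithin S) :
    (mulMatrix (sigmaCocycle ℓ 𝒦) S (basisElem _ a.1) i j,
      mulMatrix (sigmaCocycle ℓ' 𝒦) S (basisElem _ a.1) i j) ∈ (evalPair ℓ ℓ' 𝒦).range := by
  classical
  obtain ⟨⟨F, G, U⟩, hF, hG⟩ := a
  obtain ⟨⟨G', H, V⟩, hG', hH⟩ := j
  rw [mulMatrix_apply, mulMatrix_apply]
  by_cases h : G' = G
  · subst h
    rw [basisElem_mul_of_comp, basisElem_mul_of_comp, map_smul, map_smul, basisElem, basisElem,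
      Module.Basis.repr_self, Module.Basis.repr_self, Finsupp.smul_apply, Finsupp.smul_apply,
      Finsupp.single_apply, Finsupp.single_apply]
    split_ifs
    · rw [smul_eq_mul, smul_eq_mul, mul_one, mul_one]
      exact ellCard_mem_range_evalPair ℓ ℓ' G' _
    · rw [smul_zero, smul_zero]
      exact zero_mem _
  · rw [basisElem_mul_of_ne _ _ _ h, basisElem_mul_of_ne _ _ _ h, map_zero, map_zero]
    exact zero_mem _

variable [Fintype (MorWithin S)]

theorem traceGram_mem_range_evalPair (a b : MorWithin S) :
    (traceGram (sigmaCocycle ℓ 𝒦) S a b, traceGram (sigmaCocycle ℓ' 𝒦) S a b) ∈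
      (evalPair ℓ ℓ' 𝒦).range := by
  simp only [traceGram, Matrix.of_apply, Matrix.trace, Matrix.diag_apply, Matrix.mul_apply]
  rw [prod_mk_sum]
  refine sum_mem fun i _ => ?_
  rw [prod_mk_sum]
  refine sum_mem fun j _ => ?_
  rw [← Prod.mk_mul_mk]
  exact mul_mem (mulMatrix_mem_range_evalPair ℓ ℓ' S _ _ _)
    (mulMatrix_mem_range_evalPair ℓ ℓ' S _ _ _)

open Classical in
/-- The discriminants for `ℓ` and for `ℓ'` are values of one polynomial with rational
coefficients. If it vanishes at `ℓ`, then it is zero by algebraic independence. -/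
theorem traceGram_det_ne_zero_of_algebraicIndependent (hℓ : AlgIndepWithRespectTo ℓ 𝒦)
    (h : (traceGram (sigmaCocycle ℓ' 𝒦) S).det ≠ 0) :
    (traceGram (sigmaCocycle ℓ 𝒦) S).det ≠ 0 := by
  choose P hP using traceGram_mem_range_evalPair ℓ ℓ' S
  have hfst : ((AlgHom.fst ℚ 𝕂 ℝ).comp (evalPair ℓ ℓ' 𝒦)) (Matrix.of P).det =
      (traceGram (sigmaCocycle ℓ 𝒦) S).det := by
    rw [AlgHom.map_det]
    congr 1
    ext a b
    exact congrArg Prod.fst (hP a b)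
  have hsnd : ((AlgHom.snd ℚ 𝕂 ℝ).comp (evalPair ℓ ℓ' 𝒦)) (Matrix.of P).det =
      (traceGram (sigmaCocycle ℓ' 𝒦) S).det := by
    rw [AlgHom.map_det]
    congr 1
    ext a b
    exact congrArg Prod.snd (hP a b)
  have heval : (AlgHom.fst ℚ 𝕂 ℝ).comp (evalPair ℓ ℓ' 𝒦) =
      MvPolynomial.aeval fun q : primeDivisors 𝒦 => ((ℓ (q.1 : ℕ+) : 𝕂ˣ) : 𝕂) := by
    ext q
    simp [evalPair]
  intro h0
  refine h ?_
  rw [← hfst, heval] at h0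
  rw [← hsnd, hℓ.eq_zero_of_aeval_eq_zero _ h0, map_zero]

end TwistedCategoryAlgebra

/-! ### Local semisimplicity -/

theorem theorem1p1 {𝕂 : Type v} [Field 𝕂] [CharZero 𝕂] (ℓ : ℕ+ →* 𝕂ˣ)
    (𝒦 : Set FiniteGrp.{u}) (hℓ : AlgIndepWithRespectTo ℓ 𝒦) :
    IsLocallySemisimple (LambdaAlgebra ℓ 𝒦) := by
  refine ⟨TwistedCategoryAlgebra.isLocallyUnital _, fun e he => ?_⟩
  obtain ⟨S, hS⟩ := TwistedCategoryAlgebra.exists_unitOn_mul_mul e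
  have _ : Fintype (MorWithin S) := Fintype.ofFinite _
  exact TwistedCategoryAlgebra.isSemisimpleRing_corner _ S
    (TwistedCategoryAlgebra.traceGram_det_ne_zero_of_algebraicIndependent ℓ _ S hℓ
      (SubgroupCat.traceGram_pnatPowHom_det_ne_zero rfl)) he (hS S subset_rfl).1 (hS S subset_rfl).2
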